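/- Let $S$ be a commutative $*$-semigroup with zero, that is, a commutative monoid $(S,+,0)$ with an involution $s\mapsto s^*$ satisfying $(s+t)^*=s^*+t^*$ and $s^{**}=s$. A character on $S$ is a nonzero map $\sigma:S\to\mathbb{C}$ with $\sigma(s+t)=\sigma(s)\sigma(t)$ and $\sigma(s^*)=\overline{\sigma(s)}$ for all $s,t\in S$; let $S^*$ be the set of characters, with the least $\sigma$-algebra making all evaluations $\sigma\mapsto\sigma(s)$ ($s\in S$) measurable. Write $s\sim t$ if $\sigma(s)=\sigma(t)$ for all $\sigma\in S^*$, and let $[s]$ be the class of $s$ in the quotient semigroup $S/{\sim}$, whose neutral element is denoted by $0$. Let $\mathfrak{P}(S)$ be the set of positive definite functions on $S$, i.e. of all $\phi:S\to\mathbb{C}$ with $\sum_{i,j}\xi_i\overline{\xi_j}\,\phi(s_j^*+s_i)\ge 0$ for all finite families $(s_i)$ in $S$ and $(\xi_i)$ in $\mathbb{C}$. Let $\mathfrak{M}(S)\subseteq\mathfrak{P}(S)$ be the set of moment functions, i.e. of all functions $\phi(s)=\int_{S^*}\sigma(s)\,d\mu(\sigma)$, where $\mu$ is a positive measure on $S^*$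 such that all evaluations are square-integrable with respect to $\mu$. For $\phi\in\mathfrak{P}(S)$ let $\mathcal{H}^\phi$ be the Hilbert space of functions on $S$ with reproducing kernel $K^\phi(s,t)=\phi(t^*+s)$, let $K^\phi_s=K^\phi(\cdot,s)$, and for $u\in S$ let $u_\phi$ be the closure of the (well defined and closable) operator $\sum_j\xi_jK^\phi_{s_j}\mapsto\sum_j\xi_jK^\phi_{s_j+u}$ defined on the linear span of $\{K^\phi_s:s\in S\}$. The square $(u_\phi)^2$ is taken with its natural domain, and $(u_\phi)^*$ denotes the Hilbert space adjoint. For each element $u\in S$ the following conditions are equivalent: (i) $[2u]=0$ and $[u]=[u^*]$; (ii) for every $\phi\in\mathfrak{M}(S)$ we have $(u_\phi)^2=I_{\mathcal{H}^\phi}$ and $(u_\phi)^*=u_\phi$; (iii) for every $\phi\in\mathfrak{P}(S)$ we have $(u_\phi)^2=I_{\mathcal{H}^\phi}$ and $(u_\phi)^*=u_\phi$. Moreover, (i) implies that $u_\phi$ is a bounded, selfadjoint operator defined on the whole of $\mathcal{H}^\phi$ for every $\phi\in\mathfrak{P}(S)$. -/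

import Mathlib

open scoped ComplexConjugate ComplexOrder
open MeasureTheory

/-! ### Characters of a commutative `*`-semigroup with zero

A commutative `*`-semigroup with zero is written additively: it is a type `S` with instances
`AddCommMonoid S` and `StarAddMonoid S`, the involution being `star`. -/

/-- A character on `S`: a nonzero `*`-homomorphism from `S` into `ℂ`, where `ℂ` carries
multiplication as operation and conjugation as involution. -/
structure StarCharacter (S : Type*) [AddCommMonoid S] [StarAddMonoid S] where
  toFun : S → ℂ
  map_add' : ∀ s t : S, toFun (s + t) = toFun s * toFun t
  map_star' : ∀ s : S, toFun (star s) = conj (toFun s)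
  ne_zero' : toFun ≠ 0

namespace StarCharacter

variable {S : Type*} [AddCommMonoid S] [StarAddMonoid S]

instance : CoeFun (StarCharacter S) (fun _ => S → ℂ) := ⟨StarCharacter.toFun⟩

/-- The least `σ`-algebra on the set of characters for which all the evaluations `σ ↦ σ s`
are measurable. -/
noncomputable instance : MeasurableSpace (StarCharacter S) :=
  ⨆ s : S, MeasurableSpace.comap (fun σ : StarCharacter S => σ s) (borel ℂ)

end StarCharacter

/-- The congruence `s ∼ t` if and only if `σ s = σ t` for every character `σ`. Its quotient
`(charCon S).Quotient` is the greatest `*`-homomorphic `*`-separative image of `S`. -/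
def charCon (S : Type*) [AddCommMonoid S] [StarAddMonoid S] : AddCon S where
  r s t := ∀ σ : StarCharacter S, σ s = σ t
  iseqv := ⟨fun _ _ => rfl, fun h σ => (h σ).symm, fun h h' σ => (h σ).trans (h' σ)⟩
  add' := fun h h' σ => by rw [σ.map_add', σ.map_add', h σ, h' σ]

/-! ### Positive definite functions and moment functions -/

/-- Positive definite functions on `S`. The order is that of `ℂ`: `0 ≤ z` means that `z` is real
and nonnegative. -/
def IsPosDefFun {S : Type*} [AddCommMonoid S] [StarAddMonoid S] (φ : S → ℂ) : Prop :=
  ∀ (n : ℕ) (s : Fin n → S) (ξ : Fin n → ℂ),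
    0 ≤ ∑ i, ∑ j, ξ i * conj (ξ j) * φ (star (s j) + s i)

/-- Moment functions on `S`: functions `s ↦ ∫ σ s dμ(σ)` for a positive measure `μ` on the set of
characters such that all the evaluations are square-integrable. -/
def IsMomentFun {S : Type*} [AddCommMonoid S] [StarAddMonoid S] (φ : S → ℂ) : Prop :=
  ∃ μ : Measure (StarCharacter S),
    (∀ s : S, MemLp (fun σ : StarCharacter S => σ s) 2 μ) ∧
      ∀ s : S, φ s = ∫ σ : StarCharacter S, σ s ∂μ

/-- The set of positive definite functions on `S`, as a type. -/
abbrev PosDefFun (S : Type*) [AddCommMonoid S] [StarAddMonoid S] : Type _ :=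
  {φ : S → ℂ // IsPosDefFun φ}

/-- Every moment function is positive definite. -/
theorem IsMomentFun.isPosDefFun {S : Type*} [AddCommMonoid S] [StarAddMonoid S] {φ : S → ℂ}
    (hφ : IsMomentFun φ) : IsPosDefFun φ := by
  obtain ⟨μ, hμ, hφ⟩ := hφ
  intro n s ξ
  have hint : ∀ i j, Integrable
      (fun σ : StarCharacter S => ξ i * conj (ξ j) * σ (star (s j) + s i)) μ := by
    intro i j
    have h : Integrable (fun σ : StarCharacter S => σ (star (s j)) * σ (s i)) μ :=
      (hμ (star (s j))).integrable_mul (hμ (s i))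
    refine Integrable.const_mul ?_ _
    simpa only [StarCharacter.map_add'] using h
  have h1 : ∑ i, ∑ j, ξ i * conj (ξ j) * φ (star (s j) + s i) =
      ∫ σ : StarCharacter S, ∑ i, ∑ j, ξ i * conj (ξ j) * σ (star (s j) + s i) ∂μ := by
    rw [integral_finsetSum _ (fun i _ => integrable_finsetSum _ (fun j _ => hint i j))]
    refine Finset.sum_congr rfl fun i _ => ?_
    rw [integral_finsetSum _ (fun j _ => hint i j)]
    refine Finset.sum_congr rfl fun j _ => ?_
    rw [hφ, integral_const_mul]
  have h2 : ∀ σ : StarCharacter S,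
      ∑ i, ∑ j, ξ i * conj (ξ j) * σ (star (s j) + s i) =
        ((Complex.normSq (∑ i, ξ i * σ (s i)) : ℝ) : ℂ) := by
    intro σ
    rw [← Complex.mul_conj, map_sum, Finset.sum_mul_sum]
    refine Finset.sum_congr rfl fun i _ => Finset.sum_congr rfl fun j _ => ?_
    rw [σ.map_add', σ.map_star', map_mul]
    ring
  rw [h1]
  simp only [h2]
  rw [integral_complex_ofReal]
  exact_mod_cast integral_nonneg fun σ => Complex.normSq_nonneg _

/-- A moment function, as an element of the set of positive definite functions. -/
def IsMomentFun.toPosDefFun {S : Type*} [AddCommMonoid S] [StarAddMonoid S] {φ : S → ℂ}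
    (hφ : IsMomentFun φ) : PosDefFun S :=
  ⟨φ, hφ.isPosDefFun⟩

/-! ### The reproducing kernel Hilbert space -/

/-- The kernel `K(s, t) = φ(t* + s)`. Its entries are operators on the one-dimensional space `ℂ`,
that is, multiplications by scalars. -/
noncomputable def posDefKernel {S : Type*} [AddCommMonoid S] [StarAddMonoid S] (φ : S → ℂ) :
    Matrix S S (ℂ →L[ℂ] ℂ) :=
  .of fun s t => φ (star t + s) • ContinuousLinearMap.id ℂ ℂ

theorem IsPosDefFun.conj_apply {S : Type*} [AddCommMonoid S] [StarAddMonoid S] {φ : S → ℂ}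
    (hφ : IsPosDefFun φ) (s t : S) : conj (φ (star s + t)) = φ (star t + s) := by
  have hs := hφ 1 ![s] ![1]
  have ht := hφ 1 ![t] ![1]
  have h1 := hφ 2 ![s, t] ![1, 1]
  have h2 := hφ 2 ![s, t] ![1, Complex.I]
  simp [Fin.sum_univ_two, Complex.le_def] at hs ht h1 h2
  apply Complex.ext
  · simp
    linarith [h1.2, h2.2, hs.2, ht.2]
  · simp
    linarith [h1.2, h2.2, hs.2, ht.2]

theorem IsPosDefFun.posSemidef {S : Type*} [AddCommMonoid S] [StarAddMonoid S] {φ : S → ℂ}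
    (hφ : IsPosDefFun φ) : (posDefKernel φ).PosSemidef := by
  have htfae := (RKHS.posSemidef_tfae (K := posDefKernel φ)).out 0 2
  refine htfae.mpr ⟨?_, fun v => ?_⟩
  · ext s t
    have h1 : ContinuousLinearMap.id ℂ ℂ = 1 := rfl
    simp [posDefKernel, Matrix.conjTranspose_apply, hφ.conj_apply, h1]
  · have e := Fintype.equivFin v.support
    have h := hφ (Fintype.card v.support) (fun i => (e.symm i : S))
      (fun i => conj (v (e.symm i : S)))
    have h' : v.sum (fun x w => v.sum fun x' w' => inner ℂ (posDefKernel φ x' x w) w') =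
        ∑ i, ∑ j, conj (v (e.symm i : S)) * conj (conj (v (e.symm j : S))) *
          φ (star (e.symm j : S) + (e.symm i : S)) := by
      simp only [Finsupp.sum]
      rw [← Finset.sum_coe_sort, ← e.symm.sum_comp]
      refine Finset.sum_congr rfl fun i _ => ?_
      rw [← Finset.sum_coe_sort, ← e.symm.sum_comp]
      refine Finset.sum_congr rfl fun j _ => ?_
      simp [posDefKernel, hφ.conj_apply]
      ring
    rw [h']
    exact (Complex.le_def.mp h).1

instance PosDefFun.fact_posSemidef {S : Type*} [AddCommMonoid S] [StarAddMonoid S]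
    (φ : PosDefFun S) : Fact (posDefKernel φ.1).PosSemidef :=
  ⟨φ.2.posSemidef⟩

namespace PosDefFun

variable {S : Type*} [AddCommMonoid S] [StarAddMonoid S]

/-- The Hilbert space of functions on `S` with reproducing kernel `K(s, t) = φ(t* + s)`. -/
abbrev HSpace (φ : PosDefFun S) : Type _ := RKHS.OfKernel (posDefKernel φ.1)

/-- The kernel function `K_s = K(·, s)`. -/
noncomputable def kerVec (φ : PosDefFun S) (s : S) : φ.HSpace := RKHS.kerFun φ.HSpace s (1 : ℂ)

theorem kerVec_apply (φ : PosDefFun S) (s t : S) : φ.kerVec s t = φ.1 (star s + t) := by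
  rw [kerVec, RKHS.kerFun_apply, RKHS.OfKernel.kernel_ofKernel]
  simp [posDefKernel]

/-! ### Shift operators -/

/-- The linear relation consisting of the pairs `(∑ ξ_j K_{s_j}, ∑ ξ_j K_{s_j + u})`. -/
noncomputable def shiftRel (φ : PosDefFun S) (u : S) : Submodule ℂ (φ.HSpace × φ.HSpace) :=
  Submodule.span ℂ (Set.range fun s : S => (φ.kerVec s, φ.kerVec (s + u)))

/-- The shift operator `A(u, φ)`, which maps `∑ ξ_j K_{s_j}` to `∑ ξ_j K_{s_j + u}` and is defined
on the linear span of the functions `K_s`. -/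
noncomputable def preShift (φ : PosDefFun S) (u : S) : φ.HSpace →ₗ.[ℂ] φ.HSpace :=
  (φ.shiftRel u).toLinearPMap

/-- The closure `u_φ` of the shift operator `A(u, φ)`. -/
noncomputable def shift (φ : PosDefFun S) (u : S) : φ.HSpace →ₗ.[ℂ] φ.HSpace :=
  (φ.preShift u).closure

theorem apply_of_mem_closure_shiftRel (φ : PosDefFun S) (u : S) {x : φ.HSpace × φ.HSpace}
    (hx : x ∈ (φ.shiftRel u).topologicalClosure) (t : S) : x.2 t = x.1 (t + star u) := by
  let p : Submodule ℂ (φ.HSpace × φ.HSpace) :=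
    { carrier := {x | x.2 t = x.1 (t + star u)}
      add_mem' := by
        intro a b ha hb
        simp only [Set.mem_ofPred_eq] at ha hb ⊢
        simp [ha, hb]
      zero_mem' := by simp
      smul_mem' := by
        intro c a ha
        simp only [Set.mem_ofPred_eq] at ha ⊢
        simp [ha] }
  have hp : IsClosed (p : Set (φ.HSpace × φ.HSpace)) :=
    isClosed_eq ((RKHS.continuous_eval t).comp continuous_snd)
      ((RKHS.continuous_eval (t + star u)).comp continuous_fst)
  have hle : φ.shiftRel u ≤ p := by
    refine Submodule.span_le.mpr ?_
    rintro _ ⟨s, rfl⟩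
    change φ.kerVec (s + u) t = φ.kerVec s (t + star u)
    rw [kerVec_apply, kerVec_apply, star_add, add_assoc, add_comm t]
  exact Submodule.topologicalClosure_minimal _ hle hp hx

theorem closure_shiftRel_functional (φ : PosDefFun S) (u : S) (x : φ.HSpace × φ.HSpace)
    (hx : x ∈ (φ.shiftRel u).topologicalClosure) (h0 : x.1 = 0) : x.2 = 0 := by
  refine RKHS.ext fun t => ?_
  rw [φ.apply_of_mem_closure_shiftRel u hx t, h0]
  simp

/-- The shift operator is well defined. -/
theorem preShift_graph (φ : PosDefFun S) (u : S) : (φ.preShift u).graph = φ.shiftRel u :=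
  Submodule.toLinearPMap_graph_eq _ fun x hx h0 =>
    φ.closure_shiftRel_functional u x (Submodule.le_topologicalClosure _ hx) h0

/-- The shift operator is closable. -/
theorem preShift_isClosable (φ : PosDefFun S) (u : S) : (φ.preShift u).IsClosable := by
  refine ⟨(φ.shiftRel u).topologicalClosure.toLinearPMap, ?_⟩
  rw [φ.preShift_graph u, Submodule.toLinearPMap_graph_eq _ (φ.closure_shiftRel_functional u)]

/-- The graph of `u_φ` is the closure of the set of pairs `(∑ ξ_j K_{s_j}, ∑ ξ_j K_{s_j + u})`. -/
theorem shift_graph (φ : PosDefFun S) (u : S) :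
    (φ.shift u).graph = (φ.shiftRel u).topologicalClosure := by
  rw [shift, ← (φ.preShift_isClosable u).graph_closure_eq_closure_graph, φ.preShift_graph u]

end PosDefFun

/-! ### Composition of unbounded operators -/

/-- The square `T² = T ∘ T` of an unbounded operator, with its natural domain
`{x ∈ dom T : T x ∈ dom T}`. -/
def LinearPMap.square {E : Type*} [AddCommGroup E] [Module ℂ E] (T : E →ₗ.[ℂ] E) :
    E →ₗ.[ℂ] E where
  domain :=
    { carrier := {x | ∃ hx : x ∈ T.domain, T ⟨x, hx⟩ ∈ T.domain}
      add_mem' := by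
        rintro x y ⟨hx, hx'⟩ ⟨hy, hy'⟩
        exact ⟨T.domain.add_mem hx hy, by
          simpa [← T.map_add] using T.domain.add_mem hx' hy'⟩
      zero_mem' := ⟨T.domain.zero_mem, by
        have h : T ⟨0, T.domain.zero_mem⟩ = 0 := T.map_zero
        rw [h]
        exact T.domain.zero_mem⟩
      smul_mem' := by
        rintro c x ⟨hx, hx'⟩
        exact ⟨T.domain.smul_mem c hx, by
          simpa [← T.map_smul] using T.domain.smul_mem c hx'⟩ }
  toFun :=
    { toFun := fun x => T ⟨T ⟨x.1, x.2.1⟩, x.2.2⟩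
      map_add' := by
        intro x y
        rw [← T.map_add]
        congr 1
        ext
        exact T.map_add ⟨x.1, x.2.1⟩ ⟨y.1, y.2.1⟩
      map_smul' := by
        intro c x
        rw [RingHom.id_apply, ← T.map_smul]
        congr 1
        ext
        exact T.map_smul c ⟨x.1, x.2.1⟩ }

/-! Condition (i) says that `σ (2 • u) = 1` and `σ u = σ (star u)` for every character `σ`. That
(ii) implies (i) is quick: each `σ` is a moment function (Dirac measure), and the operator
identities, tested on the kernel vector `K_0`, give both equations.

The substance is (i) ⇒ (iii), since a general positive definite `φ` need not be an integral of
characters; information about characters must become algebra in `S`. Characters of the unit group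
extend by zero to `S`, so `u` is a unit. Circle-valued characters then force `2u = h + h*` and `u =
u* + (k + k*)`, and positive characters force `h + h*` and `k + k*` to have finite order
(`exists_torsion_of_character`).

For `a = h + h*`, positive definiteness makes `m ↦ φ(s* + s + m a)` convex; if `a` has finite order
the sequence is also periodic, hence constant, and `K_{s+a} = K_s` (`kerVec_add_of_torsion`). So the
shift by `u` is a symmetric involution on the span of the kernel vectors, and its closure is an
everywhere defined selfadjoint isometry. -/

/-! ### Characters of abelian groups with involution -/

/-- A subgroup of an abelian group is separated from its complement by characters with values in
the unit circle. -/
theorem AddSubgroup.exists_circle_hom_ne_one {G : Type*} [AddCommGroup G] (H : AddSubgroup G)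
    {g : G} (hg : g ∉ H) :
    ∃ χ : G → Circle, (∀ a b, χ (a + b) = χ a * χ b) ∧ (∀ a ∈ H, χ a = 1) ∧ χ g ≠ 1 := by
  have hne : (QuotientAddGroup.mk' H g) ≠ 0 := by
    simpa using hg
  obtain ⟨c, hc⟩ := CharacterModule.exists_character_apply_ne_zero_of_ne_zero hne
  -- The separating character `c` takes values in ℚ/ℤ; the embedding into ℝ/ℤ leads on to the
  -- circle.
  let ι : AddCircle (1 : ℚ) →+ AddCircle (1 : ℝ) :=
    QuotientAddGroup.map _ _ (Rat.castHom ℝ).toAddMonoidHom (by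
      rintro _ ⟨n, rfl⟩
      exact ⟨n, by simp⟩)
  have hι : ∀ x, ι x = 0 → x = 0 := by
    intro x
    induction x using QuotientAddGroup.induction_on with
    | H q =>
      intro h
      have h' : ((q : ℝ) : AddCircle (1 : ℝ)) = 0 := h
      obtain ⟨n, hn⟩ := (AddCircle.coe_eq_zero_iff (1 : ℝ)).mp h'
      refine (AddCircle.coe_eq_zero_iff (1 : ℚ)).mpr ⟨n, ?_⟩
      have : ((n • (1 : ℚ) : ℚ) : ℝ) = (q : ℝ) := by simpa using hn
      exact_mod_cast this
  let d : G →+ AddCircle (1 : ℚ) := AddMonoidHom.comp c (QuotientAddGroup.mk' H)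
  refine ⟨fun a => AddCircle.toCircle (ι (d a)), fun a b => ?_, fun a ha => ?_, fun h => hc ?_⟩
  · simp only [map_add, AddCircle.toCircle_add]
  · have h0 : QuotientAddGroup.mk' H a = 0 := by simpa using ha
    have : d a = 0 := by
      change c (QuotientAddGroup.mk' H a) = 0
      rw [h0]
      exact AddMonoidHom.map_zero c
    simp [this]
  · refine hι _ (AddCircle.injective_toCircle one_ne_zero (h.trans ?_))
    simp

/-- A `*`-homomorphism from an abelian group with involution `τ` to the multiplicative
`*`-semigroup `ℂ`, not vanishing at `0`. -/
structure IsHermitianCharacter {G : Type*} [AddCommGroup G] (τ : G →+ G) (χ : G → ℂ) : Prop where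
  map_add : ∀ a b, χ (a + b) = χ a * χ b
  map_inv : ∀ a, χ (τ a) = conj (χ a)
  map_zero : χ 0 = 1

section Group

variable {G : Type*} [AddCommGroup G] {τ : G →+ G}

/-- An element at which all unimodular hermitian characters are trivial has the form `h + h*`. -/
theorem exists_eq_add_of_hermitian_eq_one {g : G}
    (hg : ∀ χ, IsHermitianCharacter τ χ → χ g = 1) : ∃ h, g = h + τ h := by
  by_contra! hcon
  have hmem : g ∉ (AddMonoidHom.id G + τ).range := by
    rintro ⟨h, hh⟩
    exact hcon h hh.symm
  obtain ⟨χ, hadd, hH, hχ⟩ := AddSubgroup.exists_circle_hom_ne_one _ hmem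
  refine hχ (Circle.ext ?_)
  -- Triviality on all `a + τ a` says `χ (τ a) = (χ a)⁻¹`, which on the circle is the hermitian
  -- condition.
  refine hg (fun a => (χ a : ℂ)) ⟨fun a b => by simp [hadd], fun a => ?_, ?_⟩
  · have h1 : χ a * χ (τ a) = 1 := by
      rw [← hadd]
      exact hH _ ⟨a, rfl⟩
    rw [← Circle.coe_inv_eq_conj, eq_inv_of_mul_eq_one_right h1]
  · simp [hH 0 (zero_mem _)]

/-- If all positive hermitian characters are trivial at `g`, then `g + g*` has finite order. -/
theorem exists_nsmul_add_eq_zero_of_hermitian (hτ : ∀ a, τ (τ a) = a) {g : G}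
    (hg : ∀ χ, IsHermitianCharacter τ χ → χ (2 • g) = 1) :
    ∃ n : ℕ, 0 < n ∧ n • (g + τ g) = 0 := by
  by_contra! hcon
  have hinj : Function.Injective (zmultiplesHom G (g + τ g)) := by
    rw [injective_iff_map_eq_zero]
    intro m hm
    by_contra hm0
    refine hcon m.natAbs (Int.natAbs_pos.mpr hm0) ?_
    rw [zmultiplesHom_apply] at hm
    rcases Int.natAbs_eq m with h | h
    · rw [h, natCast_zsmul] at hm
      exact hm
    · rw [h, neg_zsmul, natCast_zsmul, neg_eq_zero] at hm
      exact hm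
  -- ℝ is divisible, so `m • (g + τ g) ↦ m` extends to `G`. The character `exp (f a + f (τ a))` then
  -- takes the value `e²` at `2 • g`.
  obtain ⟨f, hf⟩ := (Module.Baer.of_divisible ℝ).extension_property_addMonoidHom
    (zmultiplesHom G (g + τ g)) hinj (Int.castAddHom ℝ)
  have hfg : f g + f (τ g) = 1 := by
    have := DFunLike.congr_fun hf 1
    simpa using this
  have h := hg (fun a => ((Real.exp (f a + f (τ a)) : ℝ) : ℂ)) ⟨fun a b => ?_, fun a => ?_, ?_⟩
  · have h' : Real.exp (f (2 • g) + f (τ (2 • g))) = 1 := by exact_mod_cast h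
    rw [Real.exp_eq_one_iff, map_nsmul, map_nsmul, map_nsmul, ← nsmul_add, hfg] at h'
    norm_num at h'
  · rw [← Complex.ofReal_mul, ← Real.exp_add]
    congr 2
    simp only [map_add]
    ring
  · rw [Complex.conj_ofReal, hτ, add_comm]
  · simp

end Group

/-! ### Extending characters from the group of units -/

section Units

variable {S : Type*} [AddCommMonoid S] [StarAddMonoid S]

/-- The involution induced on the group of invertible elements. -/
def AddUnits.starHom (S : Type*) [AddCommMonoid S] [StarAddMonoid S] : AddUnits S →+ AddUnits S :=
  AddUnits.map (starAddEquiv : S ≃+ S).toAddMonoidHom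

theorem AddUnits.coe_starHom (a : AddUnits S) : (AddUnits.starHom S a : S) = star (a : S) := rfl

theorem AddUnits.starHom_starHom (a : AddUnits S) :
    AddUnits.starHom S (AddUnits.starHom S a) = a :=
  AddUnits.ext (star_star (a : S))

theorem IsAddUnit.star {s : S} (hs : IsAddUnit s) : IsAddUnit (star s) := by
  obtain ⟨a, rfl⟩ := hs
  exact ⟨AddUnits.starHom S a, rfl⟩

open Classical in
/-- The extension by zero of a character of the group of invertible elements. -/
noncomputable def IsHermitianCharacter.extend {χ : AddUnits S → ℂ}
    (hχ : IsHermitianCharacter (AddUnits.starHom S) χ) : StarCharacter S where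
  toFun s := if h : IsAddUnit s then χ h.addUnit else 0
  map_add' s t := by
    by_cases hs : IsAddUnit s
    · by_cases ht : IsAddUnit t
      · rw [dif_pos hs, dif_pos ht, dif_pos (hs.add ht), ← hχ.map_add]
        congr 1
        exact AddUnits.ext rfl
      · rw [dif_neg ht, mul_zero, dif_neg fun h => ht (isAddUnit_of_add_isAddUnit_right h)]
    · rw [dif_neg hs, zero_mul, dif_neg fun h => hs (isAddUnit_of_add_isAddUnit_left h)]
  map_star' s := by
    by_cases hs : IsAddUnit s
    · rw [dif_pos hs, dif_pos hs.star, ← hχ.map_inv]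
      congr 1
      exact AddUnits.ext rfl
    · have hs' : ¬ IsAddUnit (star s) := fun h => hs (by simpa using h.star)
      rw [dif_neg hs, dif_neg hs', _root_.map_zero]
  ne_zero' h := by
    have h0 := congrFun h 0
    have h1 : (isAddUnit_zero : IsAddUnit (0 : S)).addUnit = 0 := AddUnits.ext rfl
    simp only [dif_pos isAddUnit_zero, h1, hχ.map_zero] at h0
    exact one_ne_zero h0

theorem IsHermitianCharacter.extend_coe {χ : AddUnits S → ℂ}
    (hχ : IsHermitianCharacter (AddUnits.starHom S) χ) (a : AddUnits S) :
    hχ.extend (a : S) = χ a := by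
  have h : hχ.extend (a : S) = χ a.isAddUnit.addUnit := dif_pos a.isAddUnit
  rw [h]
  congr 1
  exact AddUnits.ext rfl

theorem IsHermitianCharacter.extend_of_not_isAddUnit {χ : AddUnits S → ℂ}
    (hχ : IsHermitianCharacter (AddUnits.starHom S) χ) {s : S} (hs : ¬ IsAddUnit s) :
    hχ.extend s = 0 :=
  dif_neg hs

theorem StarCharacter.map_zero (σ : StarCharacter S) : σ 0 = 1 := by
  have h : ∃ s, σ s ≠ 0 := by
    by_contra! h
    exact σ.ne_zero' (funext h)
  obtain ⟨s, hs⟩ := h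
  have h1 := σ.map_add' s 0
  rw [add_zero] at h1
  exact mul_left_cancel₀ hs (by rw [← h1, mul_one])

/-- If `σ (2u) = 1` and `σ u = σ u*` for all characters `σ`, then `2u = h + h*` and
`u = u* + (k + k*)` where `h + h*` and `k + k*` have finite order. -/
theorem exists_torsion_of_character {u : S} (h2 : ∀ σ : StarCharacter S, σ (2 • u) = 1)
    (hu : ∀ σ : StarCharacter S, σ u = σ (star u)) :
    (∃ (h : S) (n : ℕ), 0 < n ∧ n • (h + star h) = 0 ∧ 2 • u = h + star h) ∧
      ∃ (k : S) (n : ℕ), 0 < n ∧ n • (k + star k) = 0 ∧ u = star u + (k + star k) := by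
  -- Otherwise the trivial character of the unit group, extended by zero, would vanish at `2 • u`.
  have hunit : IsAddUnit u := by
    by_contra hcon
    have h1 : IsHermitianCharacter (AddUnits.starHom S) (fun _ => (1 : ℂ)) :=
      ⟨by simp, by simp, rfl⟩
    have h := h2 h1.extend
    rw [two_nsmul, StarCharacter.map_add', h1.extend_of_not_isAddUnit hcon] at h
    simp at h
  obtain ⟨U, rfl⟩ := hunit
  have hU2 : ∀ χ, IsHermitianCharacter (AddUnits.starHom S) χ → χ (2 • U) = 1 := by
    intro χ hχ
    rw [← hχ.extend_coe, ← h2 hχ.extend, AddUnits.val_nsmul_eq_nsmul_val]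
  have hUs : ∀ χ, IsHermitianCharacter (AddUnits.starHom S) χ →
      χ (U - AddUnits.starHom S U) = 1 := by
    intro χ hχ
    have h1 : χ U = χ (AddUnits.starHom S U) := by
      rw [← hχ.extend_coe, hu hχ.extend, ← AddUnits.coe_starHom, hχ.extend_coe]
    rw [sub_eq_add_neg, hχ.map_add, h1, ← hχ.map_add, add_neg_cancel, hχ.map_zero]
  obtain ⟨h, hh⟩ := exists_eq_add_of_hermitian_eq_one hU2
  obtain ⟨k, hk⟩ := exists_eq_add_of_hermitian_eq_one hUs
  obtain ⟨n, hn, hn0⟩ := exists_nsmul_add_eq_zero_of_hermitian AddUnits.starHom_starHom hU2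
  have hself : 2 • AddUnits.starHom S U = 2 • U := by
    rw [← map_nsmul, hh, map_add, AddUnits.starHom_starHom, add_comm]
  -- `2(h + h*) = 4U = 2(U + U*)`, because `2U = h + h*` is fixed by the involution.
  have ht : (2 * n) • (h + AddUnits.starHom S h) = 0 := by
    have h4 : (2 : ℕ) • (h + AddUnits.starHom S h) = 2 • (U + AddUnits.starHom S U) := by
      rw [← hh, nsmul_add, hself, two_nsmul]
    rw [mul_comm, mul_nsmul', h4, ← mul_nsmul', mul_comm, mul_nsmul', hn0, nsmul_zero]
  have hk2 : 2 • (k + AddUnits.starHom S k) = 0 := by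
    rw [← hk, nsmul_sub, hself, sub_self]
  refine ⟨⟨h, 2 * n, by omega, ?_, ?_⟩, k, 2, two_pos, ?_, ?_⟩
  · simpa [AddUnits.coe_starHom] using congrArg AddUnits.val ht
  · simpa [AddUnits.coe_starHom] using congrArg AddUnits.val hh
  · simpa [AddUnits.coe_starHom] using congrArg AddUnits.val hk2
  · have hk' : U = AddUnits.starHom S U + (k + AddUnits.starHom S k) := by
      rw [← hk, add_sub_cancel]
    simpa only [AddUnits.coe_starHom, AddUnits.val_add] using congrArg AddUnits.val hk'

end Units

/-! ### Invariance of positive definite functions under torsion elements `h + h*` -/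

/-- A periodic convex sequence is constant. -/
theorem eq_of_convex_of_periodic {c : ℕ → ℝ} (hc : ∀ k, 2 * c (k + 1) ≤ c k + c (k + 2)) {n : ℕ}
    (hn : 0 < n) (hper : ∀ k, c (k + n) = c k) (k : ℕ) : c (k + 1) = c k := by
  have hmono : Monotone fun k => c (k + 1) - c k :=
    monotone_nat_of_le_succ fun k => by linarith [hc k]
  have hmul : ∀ m, c (k + m * n) = c k := by
    intro m
    induction m with
    | zero => simp
    | succ m ih => rw [Nat.succ_mul, ← add_assoc, hper, ih]
  have hd : ∀ m, c (k + 1 + m * n) - c (k + m * n) = c (k + 1) - c k := by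
    intro m
    induction m with
    | zero => simp
    | succ m ih => rw [Nat.succ_mul, ← add_assoc, ← add_assoc, hper, hper, ih]
  -- Increments are monotone, and the one at `k + j` lies between those at `k` and `k + j * n`,
  -- which agree by periodicity.
  have hconst : ∀ j, c (k + j + 1) - c (k + j) = c (k + 1) - c k := by
    intro j
    refine le_antisymm ?_ (hmono (Nat.le_add_right k j))
    rw [← hd j, add_right_comm k 1 (j * n)]
    exact hmono (Nat.add_le_add_left (Nat.le_mul_of_pos_right j hn) k)
  have hlin : ∀ j : ℕ, c (k + j) = c k + j * (c (k + 1) - c k) := by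
    intro j
    induction j with
    | zero => simp
    | succ j ih =>
      push_cast
      rw [← add_assoc]
      linarith [hconst j]
  have h := hlin n
  rw [hper] at h
  have h0 : (n : ℝ) * (c (k + 1) - c k) = 0 := by linarith
  rcases mul_eq_zero.mp h0 with h | h
  · exact absurd (Nat.cast_eq_zero.mp h) hn.ne'
  · linarith

/-! ### Symmetric involutions as unbounded operators -/

section Involution

variable {E : Type*} [NormedAddCommGroup E] [InnerProductSpace ℂ E]

theorem Submodule.swap_mem_topologicalClosure_span {A : Set (E × E)}
    (hA : ∀ x ∈ A, x.swap ∈ A) {x : E × E} (hx : x ∈ (span ℂ A).topologicalClosure) :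
    x.swap ∈ (span ℂ A).topologicalClosure := by
  let e : E × E →L[ℂ] E × E :=
    (ContinuousLinearMap.snd ℂ E E).prod (ContinuousLinearMap.fst ℂ E E)
  have hle : span ℂ A ≤ (span ℂ A).topologicalClosure.comap (e : E × E →ₗ[ℂ] E × E) :=
    span_le.mpr fun y hy => le_topologicalClosure _ (subset_span (hA y hy))
  exact topologicalClosure_minimal _ hle
    ((isClosed_topologicalClosure _).preimage e.continuous) hx

theorem Submodule.inner_eq_of_mem_topologicalClosure_span {A : Set (E × E)} {x : E × E}
    (hA : ∀ y ∈ A, inner ℂ x.2 y.1 = inner ℂ x.1 y.2) {y : E × E}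
    (hy : y ∈ (span ℂ A).topologicalClosure) : inner ℂ x.2 y.1 = inner ℂ x.1 y.2 := by
  let f : E × E →L[ℂ] ℂ := innerSL ℂ x.2 ∘L ContinuousLinearMap.fst ℂ E E -
    innerSL ℂ x.1 ∘L ContinuousLinearMap.snd ℂ E E
  have hf : ∀ z, f z = inner ℂ x.2 z.1 - inner ℂ x.1 z.2 := fun z => rfl
  have hle : span ℂ A ≤ LinearMap.ker (f : E × E →ₗ[ℂ] ℂ) :=
    span_le.mpr fun z hz => (hf z).trans (sub_eq_zero.mpr (hA z hz))
  have h : f y = 0 := topologicalClosure_minimal _ hle (isClosed_singleton.preimage f.continuous) hy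
  rwa [hf, sub_eq_zero] at h

/-- A densely defined closed operator which is symmetric and whose graph is invariant under the
exchange of coordinates is an everywhere defined selfadjoint involution. -/
theorem LinearPMap.exists_eq_toPMap_of_symmetric_involutive [CompleteSpace E] {T : E →ₗ.[ℂ] E}
    (hT : _root_.IsClosed (T.graph : Set (E × E))) (hswap : ∀ x ∈ T.graph, x.swap ∈ T.graph)
    (hsymm : ∀ x ∈ T.graph, ∀ y ∈ T.graph, inner ℂ x.2 y.1 = inner ℂ x.1 y.2)
    (hdense : T.domain.topologicalClosure = ⊤) :
    ∃ B : E →L[ℂ] E, T = (B : E →ₗ[ℂ] E).toPMap ⊤ ∧ IsSelfAdjoint B ∧ ∀ x, B (B x) = x := by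
  -- Symmetry is applied to `x` and its swap. The first projection of the graph is then isometric
  -- for the sup norm, so its range is closed; being dense, it is everything.
  have hnorm : ∀ x ∈ T.graph, ‖x.2‖ = ‖x.1‖ := fun x hx => by
    have h : inner ℂ x.2 x.2 = inner ℂ x.1 x.1 := hsymm x hx x.swap (hswap x hx)
    rw [← sq_eq_sq₀ (norm_nonneg _) (norm_nonneg _), ← @inner_self_eq_norm_sq ℂ,
      ← @inner_self_eq_norm_sq ℂ, h]
  have hcomplete : CompleteSpace T.graph := hT.completeSpace_coe
  let P : T.graph →ₗᵢ[ℂ] E :=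
    { toLinearMap := LinearMap.fst ℂ E E ∘ₗ T.graph.subtype
      norm_map' := fun x => by
        change ‖x.1.1‖ = ‖x.1‖
        rw [Prod.norm_def, hnorm x.1 x.2, max_self] }
  have hrange : LinearMap.range P.toLinearMap = ⊤ := by
    have hcl : _root_.IsClosed (LinearMap.range P.toLinearMap : Set E) :=
      P.isometry.isClosedEmbedding.isClosed_range
    rw [eq_top_iff, ← hdense]
    exact Submodule.topologicalClosure_minimal _
      (fun x hx => ⟨⟨_, T.mem_graph ⟨x, hx⟩⟩, rfl⟩) hcl
  let e := LinearIsometryEquiv.ofSurjective P (LinearMap.range_eq_top.mp hrange)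
  let B : E →L[ℂ] E :=
    (ContinuousLinearMap.snd ℂ E E ∘L T.graph.subtypeL) ∘L
      (e.symm.toContinuousLinearEquiv : E →L[ℂ] T.graph)
  have hB : ∀ x, (x, B x) ∈ T.graph := by
    intro x
    have h1 : (e.symm x).1.1 = x := e.apply_symm_apply x
    have h2 : (x, B x) = (e.symm x).1 := Prod.ext h1.symm rfl
    rw [h2]
    exact (e.symm x).2
  have huniq : ∀ {x y}, (x, y) ∈ T.graph → B x = y := fun hxy =>
    T.mem_graph_snd_inj (hB _) hxy rfl
  refine ⟨B, ?_, ?_, fun x => huniq (hswap _ (hB x))⟩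
  · refine LinearPMap.eq_of_eq_graph (Submodule.ext ?_)
    rintro ⟨x, y⟩
    constructor
    · intro hxy
      exact (LinearPMap.mem_graph_iff _).mpr ⟨⟨x, trivial⟩, rfl, huniq hxy⟩
    · intro hxy
      obtain ⟨x', hx1, hx2⟩ := (LinearPMap.mem_graph_iff _).mp hxy
      have h : B x = y := (congrArg B hx1.symm).trans hx2
      exact h ▸ hB x
  · rw [ContinuousLinearMap.isSelfAdjoint_iff_isSymmetric]
    exact fun x y => hsymm _ (hB x) _ (hB y)

/-- A bounded selfadjoint involution, viewed as an unbounded operator. -/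
theorem LinearPMap.square_eq_id_and_adjoint_eq [CompleteSpace E] {T : E →ₗ.[ℂ] E} {B : E →L[ℂ] E}
    (hT : T = (B : E →ₗ[ℂ] E).toPMap ⊤) (hB : IsSelfAdjoint B) (hBB : ∀ x, B (B x) = x) :
    T.square = LinearMap.id.toPMap ⊤ ∧ T.adjoint = T := by
  subst hT
  constructor
  · refine LinearPMap.ext ?_ ?_
    · ext x
      exact ⟨fun _ => trivial, fun _ => ⟨trivial, trivial⟩⟩
    · intro x hx hx'
      exact hBB x
  · rw [ContinuousLinearMap.toPMap_adjoint_eq_adjoint_toPMap_of_dense B (by simp)]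
    rw [show ContinuousLinearMap.adjoint B = B from hB]

end Involution

/-! ### Kernel vectors and their distances -/

namespace PosDefFun

variable {S : Type*} [AddCommMonoid S] [StarAddMonoid S]

theorem inner_kerVec_right (φ : PosDefFun S) (f : φ.HSpace) (s : S) :
    inner ℂ f (φ.kerVec s) = conj (f s) := by
  rw [kerVec, RKHS.inner_kerFun]
  simp

theorem inner_kerVec_kerVec (φ : PosDefFun S) (s t : S) :
    inner ℂ (φ.kerVec s) (φ.kerVec t) = φ.1 (star t + s) := by
  rw [inner_kerVec_right, kerVec_apply, φ.2.conj_apply]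

/-- Nonnegativity of the right side yields the convexity inequalities below; its vanishing yields
equality of kernel vectors. -/
theorem re_kerVec_sub (φ : PosDefFun S) (s t : S) :
    ‖φ.kerVec s - φ.kerVec t‖ ^ 2 =
      (φ.1 (star s + s)).re - 2 * (φ.1 (star t + s)).re + (φ.1 (star t + t)).re := by
  rw [@norm_sub_sq ℂ, ← inner_kerVec_kerVec, ← inner_kerVec_kerVec, ← inner_kerVec_kerVec,
    ← @inner_self_eq_norm_sq ℂ, ← @inner_self_eq_norm_sq ℂ]
  rfl

/-- Positive definite functions are invariant under `h + h*` if this element has finite order. -/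
theorem kerVec_add_of_torsion (φ : PosDefFun S) {h : S} {n : ℕ} (hn : 0 < n)
    (hh : n • (h + star h) = 0) (s : S) : φ.kerVec (s + (h + star h)) = φ.kerVec s := by
  set a := h + star h with ha
  have hsa : star a = a := by rw [ha, star_add, star_star, add_comm]
  have hsma : ∀ m : ℕ, star (m • a) = m • a := fun m => by rw [star_nsmul, hsa]
  let c : ℕ → ℝ := fun k => (φ.1 (star s + s + k • a)).re
  have hconv : ∀ k, 2 * c (k + 1) ≤ c k + c (k + 2) := by
    intro k
    -- For even `k`, compare `K` at `s + m a` and `s + (m + 1) a`. For odd `k`, shift both points by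
    -- `h`, which adds exactly one `a = h + h*`; a hermitian `a` not of this form would give only
    -- the even case.
    rcases Nat.even_or_odd' k with ⟨m, rfl | rfl⟩
    · have h1 := φ.re_kerVec_sub (s + m • a) (s + (m + 1) • a)
      have e1 : star (s + m • a) + (s + m • a) = star s + s + (2 * m) • a := by
        rw [star_add, hsma, two_mul, add_nsmul]; abel
      have e2 : star (s + (m + 1) • a) + (s + m • a) = star s + s + (2 * m + 1) • a := by
        rw [star_add, hsma, two_mul, add_nsmul, add_nsmul, add_nsmul]; abel
      have e3 : star (s + (m + 1) • a) + (s + (m + 1) • a) = star s + s + (2 * m + 2) • a := by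
        rw [star_add, hsma, show 2 * m + 2 = (m + 1) + (m + 1) by ring, add_nsmul (m := m + 1)]; abel
      rw [e1, e2, e3] at h1
      have := sq_nonneg ‖φ.kerVec (s + m • a) - φ.kerVec (s + (m + 1) • a)‖
      simp only [c]
      linarith
    · have key : ∀ p q : ℕ, star (s + h + p • a) + (s + h + q • a) =
          star s + s + (p + q + 1) • a := by
        intro p q
        have e : star (s + h + p • a) + (s + h + q • a) =
            star s + s + (p • a + q • a + (h + star h)) := by
          rw [star_add, star_add, hsma]; abel
        rw [e, ← ha, add_nsmul, add_nsmul, one_nsmul]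
      have h1 := φ.re_kerVec_sub (s + h + m • a) (s + h + (m + 1) • a)
      rw [key, key, key, show m + m + 1 = 2 * m + 1 by ring,
        show m + 1 + m + 1 = 2 * m + 1 + 1 by ring,
        show m + 1 + (m + 1) + 1 = 2 * m + 1 + 2 by ring] at h1
      have := sq_nonneg ‖φ.kerVec (s + h + m • a) - φ.kerVec (s + h + (m + 1) • a)‖
      simp only [c]
      linarith
  have hper : ∀ k, c (k + n) = c k := fun k => by simp only [c, add_nsmul, hh, add_zero]
  have hc := eq_of_convex_of_periodic hconv hn hper
  have h1 := φ.re_kerVec_sub (s + a) s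
  have e1 : star (s + a) + (s + a) = star s + s + 2 • a := by
    rw [star_add, hsa, two_nsmul]; abel
  have e2 : star s + (s + a) = star s + s + 1 • a := by rw [one_nsmul, add_assoc]
  have e3 : star s + s = star s + s + 0 • a := by rw [zero_nsmul, add_zero]
  rw [e1, e2, e3] at h1
  have h2 : ‖φ.kerVec (s + a) - φ.kerVec s‖ ^ 2 = c 2 - 2 * c 1 + c 0 := by
    simpa [c] using h1
  have h3 : ‖φ.kerVec (s + a) - φ.kerVec s‖ = 0 := by
    rw [← sq_eq_zero_iff, h2]
    linarith [hc 0, hc 1]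
  exact sub_eq_zero.mp (norm_eq_zero.mp h3)

/-! ### Shift operators that are symmetries -/

theorem kerVec_mem_shift_graph (φ : PosDefFun S) (u s : S) :
    (φ.kerVec s, φ.kerVec (s + u)) ∈ (φ.shift u).graph := by
  rw [shift_graph]
  exact Submodule.le_topologicalClosure _ (Submodule.subset_span ⟨s, rfl⟩)

theorem dense_span_kerVec (φ : PosDefFun S) :
    (Submodule.span ℂ (Set.range φ.kerVec)).topologicalClosure = ⊤ := by
  rw [eq_top_iff, ← RKHS.kerFun_dense φ.HSpace]
  refine Submodule.topologicalClosure_mono (Submodule.span_le.mpr ?_)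
  rintro _ ⟨s, v, rfl⟩
  have h : RKHS.kerFun φ.HSpace s v = v • φ.kerVec s := by
    rw [kerVec, ← map_smul, smul_eq_mul, mul_one]
  rw [h]
  exact Submodule.smul_mem _ _ (Submodule.subset_span ⟨s, rfl⟩)

section Symmetry

variable {φ : PosDefFun S} {u : S}

theorem swap_mem_shift_graph (h2 : ∀ s, φ.kerVec (s + u + u) = φ.kerVec s)
    {x : φ.HSpace × φ.HSpace} (hx : x ∈ (φ.shift u).graph) : x.swap ∈ (φ.shift u).graph := by
  rw [shift_graph] at hx ⊢
  refine Submodule.swap_mem_topologicalClosure_span ?_ hx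
  rintro _ ⟨s, rfl⟩
  refine ⟨s + u, ?_⟩
  simp only [h2, Prod.swap_prod_mk]

/-- By the reproducing property it suffices to compare values, and `u_φ` acts on functions by
translation of the argument by `star u`. -/
theorem inner_shift_graph (hs : ∀ s, φ.kerVec (s + u) = φ.kerVec (s + star u))
    {x y : φ.HSpace × φ.HSpace} (hx : x ∈ (φ.shift u).graph) (hy : y ∈ (φ.shift u).graph) :
    inner ℂ x.2 y.1 = inner ℂ x.1 y.2 := by
  rw [shift_graph] at hx hy
  refine Submodule.inner_eq_of_mem_topologicalClosure_span ?_ hy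
  rintro _ ⟨s, rfl⟩
  change inner ℂ x.2 (φ.kerVec s) = inner ℂ x.1 (φ.kerVec (s + u))
  rw [hs, inner_kerVec_right, inner_kerVec_right, φ.apply_of_mem_closure_shiftRel u hx]

/-- If the shift by `u` is symmetric and involutive on the kernel functions, then `u_φ` is a
selfadjoint unitary operator defined everywhere. -/
theorem exists_shift_eq_toPMap (h2 : ∀ s, φ.kerVec (s + u + u) = φ.kerVec s)
    (hs : ∀ s, φ.kerVec (s + u) = φ.kerVec (s + star u)) :
    ∃ B : φ.HSpace →L[ℂ] φ.HSpace, φ.shift u = (B : φ.HSpace →ₗ[ℂ] φ.HSpace).toPMap ⊤ ∧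
      IsSelfAdjoint B ∧ ∀ x, B (B x) = x := by
  refine LinearPMap.exists_eq_toPMap_of_symmetric_involutive ?_
    (fun x hx => swap_mem_shift_graph h2 hx) (fun x hx y hy => inner_shift_graph hs hx hy) ?_
  · rw [shift_graph]
    exact Submodule.isClosed_topologicalClosure _
  · rw [eq_top_iff, ← φ.dense_span_kerVec]
    refine Submodule.topologicalClosure_mono (Submodule.span_le.mpr ?_)
    rintro _ ⟨s, rfl⟩
    exact LinearPMap.mem_domain_of_mem_graph (φ.kerVec_mem_shift_graph u s)

end Symmetry

/-- If every character takes a real value of modulus one at `u`, then so do the shifts `u_φ`: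
they are selfadjoint unitary operators. -/
theorem exists_shift_eq_toPMap_of_character {u : S}
    (h2 : ∀ σ : StarCharacter S, σ (2 • u) = 1)
    (hu : ∀ σ : StarCharacter S, σ u = σ (star u)) (φ : PosDefFun S) :
    ∃ B : φ.HSpace →L[ℂ] φ.HSpace, φ.shift u = (B : φ.HSpace →ₗ[ℂ] φ.HSpace).toPMap ⊤ ∧
      IsSelfAdjoint B ∧ ∀ x, B (B x) = x := by
  obtain ⟨⟨h, n, hn, hh, hh2⟩, k, m, hm, hk, hk2⟩ := exists_torsion_of_character h2 hu
  refine exists_shift_eq_toPMap (fun s => ?_) fun s => ?_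
  · rw [add_assoc, ← two_nsmul, hh2, φ.kerVec_add_of_torsion hn hh]
  · conv_lhs => rw [hk2]
    rw [← add_assoc, φ.kerVec_add_of_torsion hm hk]

end PosDefFun

/-! ### From shift operators back to characters -/

theorem StarCharacter.measurable_eval {S : Type*} [AddCommMonoid S] [StarAddMonoid S] (s : S) :
    Measurable fun σ : StarCharacter S => σ s := by
  rw [measurable_iff_comap_le, Complex.borelSpace.measurable_eq]
  exact le_iSup (fun s : S =>
    MeasurableSpace.comap (fun σ : StarCharacter S => σ s) (borel ℂ)) s

/-- Characters are moment functions, being represented by Dirac measures. -/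
theorem StarCharacter.isMomentFun {S : Type*} [AddCommMonoid S] [StarAddMonoid S]
    (σ : StarCharacter S) : IsMomentFun (σ : S → ℂ) := by
  refine ⟨Measure.dirac σ, fun s => ?_, fun s => ?_⟩
  · have hm := (StarCharacter.measurable_eval (S := S) s)
    refine (memLp_congr_ae ?_).mpr (memLp_const (σ s))
    rw [Filter.EventuallyEq, ae_dirac_iff (measurableSet_eq_fun hm measurable_const)]
  · rw [integral_dirac' _ _ (StarCharacter.measurable_eval s).stronglyMeasurable]

/-- If the shift by `u` is a selfadjoint involution for the moment function `σ`, then `σ u` is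
real and `σ (2u) = 1`. -/
theorem StarCharacter.apply_of_shift {S : Type*} [AddCommMonoid S] [StarAddMonoid S] {u : S}
    (σ : StarCharacter S)
    (h2 : (σ.isMomentFun.toPosDefFun.shift u).square = LinearMap.id.toPMap ⊤)
    (hs : (σ.isMomentFun.toPosDefFun.shift u).adjoint = σ.isMomentFun.toPosDefFun.shift u) :
    σ (2 • u) = 1 ∧ σ u = σ (star u) := by
  set φ := σ.isMomentFun.toPosDefFun with hφ
  have hφσ : ∀ s, φ.1 s = σ s := fun _ => rfl
  have hdom : ∀ x, x ∈ (φ.shift u).square.domain := fun x => by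
    rw [h2]
    trivial
  have hT : ∀ s, ∀ hx : φ.kerVec s ∈ (φ.shift u).domain,
      φ.shift u ⟨φ.kerVec s, hx⟩ = φ.kerVec (s + u) := fun s hx =>
    (φ.shift u).mem_graph_snd_inj ((φ.shift u).mem_graph ⟨_, hx⟩)
      (φ.kerVec_mem_shift_graph u s) rfl
  constructor
  · have hid : ∀ (T : φ.HSpace →ₗ.[ℂ] φ.HSpace), T = LinearMap.id.toPMap ⊤ →
        ∀ x : T.domain, T x = x := by
      rintro _ rfl x
      rfl
    have hsq := hid _ h2 ⟨φ.kerVec 0, hdom _⟩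
    obtain ⟨hx, hx'⟩ := hdom (φ.kerVec 0)
    have h1 : φ.shift u ⟨φ.shift u ⟨φ.kerVec 0, hx⟩, hx'⟩ = φ.kerVec 0 := hsq
    have hx'' : φ.kerVec (0 + u) ∈ (φ.shift u).domain := hT 0 hx ▸ hx'
    have h3 : (⟨φ.shift u ⟨φ.kerVec 0, hx⟩, hx'⟩ : (φ.shift u).domain) =
        ⟨φ.kerVec (0 + u), hx''⟩ := Subtype.ext (hT 0 hx)
    rw [h3, hT] at h1
    -- Evaluating `K_{2u} = K_0` at `0` gives `conj (σ (2 • u)) = 1`.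
    have h4 := congrArg (fun f : φ.HSpace => f 0) h1
    simp only [PosDefFun.kerVec_apply, hφσ] at h4
    rw [add_zero, add_zero, zero_add, σ.map_star', star_zero, σ.map_zero] at h4
    rw [two_nsmul]
    simpa using congrArg conj h4
  -- `LinearPMap.adjoint` is a default value unless the domain is dense; here the square, hence
  -- `u_φ`, is everywhere defined.
  · have hdense : Dense ((φ.shift u).domain : Set φ.HSpace) := fun x =>
      subset_closure (hdom x).1
    have hfa := LinearPMap.adjoint_isFormalAdjoint hdense
    rw [hs] at hfa
    have h0 : φ.kerVec 0 ∈ (φ.shift u).domain := (hdom _).1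
    have h := hfa ⟨_, h0⟩ ⟨_, h0⟩
    rw [hT 0 h0, PosDefFun.inner_kerVec_kerVec, PosDefFun.inner_kerVec_kerVec, hφσ, hφσ] at h
    simpa using h

theorem proposition1 {S : Type*} [AddCommMonoid S] [StarAddMonoid S] (u : S) :
    List.TFAE [
      ((2 • u : S) : (charCon S).Quotient) = 0 ∧
        (u : (charCon S).Quotient) = ((star u : S) : (charCon S).Quotient),
      ∀ (φ : S → ℂ) (hφ : IsMomentFun φ),
        (hφ.toPosDefFun.shift u).square = LinearMap.id.toPMap ⊤ ∧
          (hφ.toPosDefFun.shift u).adjoint = hφ.toPosDefFun.shift u,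
      ∀ φ : PosDefFun S,
        (φ.shift u).square = LinearMap.id.toPMap ⊤ ∧ (φ.shift u).adjoint = φ.shift u] ∧
    (((2 • u : S) : (charCon S).Quotient) = 0 ∧
        (u : (charCon S).Quotient) = ((star u : S) : (charCon S).Quotient) →
      ∀ φ : PosDefFun S, ∃ B : φ.HSpace →L[ℂ] φ.HSpace,
        φ.shift u = (B : φ.HSpace →ₗ[ℂ] φ.HSpace).toPMap ⊤ ∧ IsSelfAdjoint B) := by
  have hiff : (((2 • u : S) : (charCon S).Quotient) = 0 ∧
      (u : (charCon S).Quotient) = ((star u : S) : (charCon S).Quotient)) ↔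
      (∀ σ : StarCharacter S, σ (2 • u) = 1) ∧ ∀ σ : StarCharacter S, σ u = σ (star u) := by
    refine and_congr ?_ ((charCon S).eq)
    rw [show (0 : (charCon S).Quotient) = ((0 : S) : (charCon S).Quotient) from rfl,
      (charCon S).eq]
    refine forall_congr' fun σ => ?_
    rw [σ.map_zero]
  rw [hiff]
  refine ⟨?_, fun h φ => ?_⟩
  · tfae_have 1 → 3 := fun h φ => by
      obtain ⟨B, hT, hB, hBB⟩ := PosDefFun.exists_shift_eq_toPMap_of_character h.1 h.2 φ
      exact LinearPMap.square_eq_id_and_adjoint_eq hT hB hBB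
    tfae_have 3 → 2 := fun h φ hφ => h hφ.toPosDefFun
    tfae_have 2 → 1 := fun h =>
      ⟨fun σ => (σ.apply_of_shift (h _ σ.isMomentFun).1 (h _ σ.isMomentFun).2).1,
        fun σ => (σ.apply_of_shift (h _ σ.isMomentFun).1 (h _ σ.isMomentFun).2).2⟩
    tfae_finish
  · obtain ⟨B, hT, hB, -⟩ := PosDefFun.exists_shift_eq_toPMap_of_character h.1 h.2 φ
    exact ⟨B, hT, hB⟩
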